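/- For a closed set $A\subset\mathbb{R}^D$ let $Med(A)$ be its medial axis, i.e. the set of points $z\in\mathbb{R}^D$ for which there are $p\neq q$ in $A$ with $\|p-z\|=\|q-z\|=d(z,A)$, and let $\tau_A=\inf_{z\in Med(A)}d(z,A)\in[0,\infty]$ be its reach. Let $M\subset\mathbb{R}^D$ be a compact (embedded, boundaryless, at least $C^1$) submanifold with reach $0<\tau_M<\infty$. Let $q_1\neq q_2$ be a reach attaining pair of $M$ with axis point $z_0$, that is, $q_1,q_2\in M$, $z_0\in Med(M)$, and $q_1,q_2$ belong to the closed ball of centre $z_0$ and radius $\tau_M$; suppose that $\|q_1-q_2\|<2\tau_M$. Then $\|q_1-z_0\|=\|q_2-z_0\|=\tau_M$, and the shorter arc $c_{z_0}(q_1,q_2)$, with endpoints $q_1$ and $q_2$, of the circle of centre $z_0$ and radius $\tau_M$ through $q_1$ and $q_2$ is contained in $M$. Moreover this arc, which has constant curvature $1/\tau_M$ and length $\tau_M\cdot\angle(q_1-z_0,q_2-z_0)$, is the geodesic of $M$ joining $q_1$ and $q_2$: its smooth arc-length parametrization from $q_1$ to $q_2$ has minimal length $\int\|c'(t)\|\,dt$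 among all $C^1$ paths $c$ in $M$ from $q_1$ to $q_2$; it is the only arc-length parametrized $C^1$ path from $q_1$ to $q_2$ in $M$ of minimal length; and every $C^1$ path from $q_1$ to $q_2$ in $M$ of minimal length has image $c_{z_0}(q_1,q_2)$. -/

import Mathlib

open scoped ContDiff

/-- The medial axis of `A`: the points having at least two nearest neighbours on `A`. -/
def medialAxis {D : ℕ} (A : Set (EuclideanSpace ℝ (Fin D))) : Set (EuclideanSpace ℝ (Fin D)) :=
  {z | ∃ p ∈ A, ∃ q ∈ A, p ≠ q ∧ dist p z = Metric.infDist z A ∧ dist q z = Metric.infDist z A}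

/-- The reach of `A`: the infimum over the medial axis of the distance to `A`.
It takes values in `[0, ∞]`, and is `∞` when the medial axis is empty. -/
noncomputable def reach {D : ℕ} (A : Set (EuclideanSpace ℝ (Fin D))) : ENNReal :=
  ⨅ z ∈ medialAxis A, Metric.infEDist z A

/-- `M` is an embedded `d`-dimensional submanifold of `ℝ^D` without boundary, of class `C^k`:
around each of its points there is a `C^k` diffeomorphism between open sets of `ℝ^D`
that straightens `M` to a `d`-dimensional linear subspace. -/
def IsSubmanifold {D : ℕ} (k : ℕ∞) (d : ℕ) (M : Set (EuclideanSpace ℝ (Fin D))) : Prop :=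
  ∀ p ∈ M, ∃ Φ : OpenPartialHomeomorph (EuclideanSpace ℝ (Fin D)) (EuclideanSpace ℝ (Fin D)),
    p ∈ Φ.source ∧ ContDiffOn ℝ k Φ Φ.source ∧ ContDiffOn ℝ k Φ.symm Φ.target ∧
      ∃ V : Submodule ℝ (EuclideanSpace ℝ (Fin D)), Module.finrank ℝ V = d ∧
        ∀ x ∈ Φ.source, (x ∈ M ↔ Φ x ∈ V)

/-- `(q₁, q₂)` is a reach attaining pair of `M` with axis point `z`: two distinct points of `M`
in the closed ball centred at the medial axis point `z`, of radius the reach of `M`. -/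
structure IsReachAttainingPair {D : ℕ} (M : Set (EuclideanSpace ℝ (Fin D)))
    (q₁ q₂ z : EuclideanSpace ℝ (Fin D)) : Prop where
  left_mem : q₁ ∈ M
  right_mem : q₂ ∈ M
  ne : q₁ ≠ q₂
  axis_mem : z ∈ medialAxis M
  left_le : edist q₁ z ≤ reach M
  right_le : edist q₂ z ≤ reach M

/-- For `q₁, q₂` on a common sphere with centre `z` and not antipodal on it, the shorter arc with
endpoints `q₁` and `q₂` of the circle with centre `z` through them, i.e. the part of that circle
inside the convex angular sector with apex `z` spanned by `q₁` and `q₂`. -/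
def shorterArc {D : ℕ} (z q₁ q₂ : EuclideanSpace ℝ (Fin D)) : Set (EuclideanSpace ℝ (Fin D)) :=
  {x | dist x z = dist q₁ z ∧
    ∃ a b : ℝ, 0 ≤ a ∧ 0 ≤ b ∧ x - z = a • (q₁ - z) + b • (q₂ - z)}

/-- `c : [a, b] → M` is a continuously differentiable path from `p` to `q` in `M`. -/
structure IsPathIn {D : ℕ} (M : Set (EuclideanSpace ℝ (Fin D)))
    (p q : EuclideanSpace ℝ (Fin D)) (a b : ℝ) (c : ℝ → EuclideanSpace ℝ (Fin D)) : Prop where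
  le : a ≤ b
  contDiffOn : ContDiffOn ℝ 1 c (Set.Icc a b)
  mapsTo : Set.MapsTo c (Set.Icc a b) M
  source : c a = p
  target : c b = q

/-- The length of the path `c : [a, b] → ℝ^D`. -/
noncomputable def pathLength {D : ℕ} (a b : ℝ) (c : ℝ → EuclideanSpace ℝ (Fin D)) : ℝ :=
  ∫ t in a..b, ‖derivWithin c (Set.Icc a b) t‖

/-- `c : [a, b] → M` is a geodesic from `p` to `q`, that is, a path in `M` from `p` to `q` whose
length is minimal among all the paths in `M` from `p` to `q`. -/
def IsGeodesic {D : ℕ} (M : Set (EuclideanSpace ℝ (Fin D)))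
    (p q : EuclideanSpace ℝ (Fin D)) (a b : ℝ) (c : ℝ → EuclideanSpace ℝ (Fin D)) : Prop :=
  IsPathIn M p q a b c ∧
    ∀ (a' b' : ℝ) (c' : ℝ → EuclideanSpace ℝ (Fin D)),
      IsPathIn M p q a' b' c' → pathLength a b c ≤ pathLength a' b' c'

/-!
Below the reach nearest points are unique, and then the distance to `M` has slope `1` at every
point off `M`: moving away from the nearest point, the nearest points stay nearby. Maximizing
`infDist · M - κ * dist · x` over balls and letting `κ → 1`, each `x` off `M` has at any distance
`s ≤ τ - infDist x M` a point `y` with `infDist y M = infDist x M + s`.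

Let `a, b ∈ M` lie on the sphere of centre `z₀` and radius `τ`, whose open ball misses `M`, and let
`c` be their midpoint. A point `y` at distance `τ - infDist c M` from `c` with `infDist y M = τ` is
at distance at least `τ` from `a` and `b`, so the median formula gives
`infDist c M ≤ τ - dist c z₀`. As the ball misses `M`, the nearest point of `c` is the radial
projection of `c` to the sphere. So `M` contains the midpoint of the arc from `a` to `b`, and by
iteration and closedness the whole arc.

A path outside the ball is at least as long as `τ` times the angle it spans at `z₀`. In the case of
equality it is on the sphere (outside a larger ball the bound would be strict) and its angles at
`z₀` add up, which forces it onto the arc.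
-/

open Set Metric Filter Topology Real InnerProductGeometry
open scoped EuclideanGeometry

section NearestPoints

variable {X : Type*} [PseudoMetricSpace X] {M : Set X} {x p : X}

/-- `p` is a point of `M` realizing the distance from `x` to `M`. -/
structure IsNearestPoint (M : Set X) (x p : X) : Prop where
  mem : p ∈ M
  dist_eq : dist x p = infDist x M

/-- No point at distance less than `R` from `M` has two nearest points on `M`: this is how a lower
bound `R` on the reach of `M` enters the argument. -/
def HasUniqueNearestPoints (M : Set X) (R : ℝ) : Prop :=
  ∀ ⦃x p q⦄, infDist x M < R → IsNearestPoint M x p → IsNearestPoint M x q → p = q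

theorem exists_isNearestPoint [ProperSpace X] (hM : IsClosed M) (hne : M.Nonempty) (x : X) :
    ∃ p, IsNearestPoint M x p :=
  let ⟨p, hp, hxp⟩ := hM.exists_infDist_eq_dist hne x
  ⟨p, hp, hxp.symm⟩

theorem eventually_isNearestPoint_dist_lt [ProperSpace X] (hM : IsClosed M)
    (huniq : ∀ q, IsNearestPoint M x q → q = p) {δ : ℝ} (hδ : 0 < δ) :
    ∀ᶠ y in 𝓝 x, ∀ q, IsNearestPoint M y q → dist q p < δ := by
  set K := M \ ball p δ
  have mem_K : ∀ {q}, q ∈ M → δ ≤ dist q p → q ∈ K := fun hq h => ⟨hq, by simpa using h⟩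
  rcases K.eq_empty_or_nonempty with hK | hK
  · refine Eventually.of_forall fun y q hq => lt_of_not_ge fun h => ?_
    simpa [hK] using mem_K hq.mem h
  · obtain ⟨m, hm, hxm⟩ := (hM.sdiff isOpen_ball).exists_infDist_eq_dist hK x
    have hgap : infDist x M < infDist x K := by
      refine hxm ▸ (infDist_le_dist_of_mem hm.1).lt_of_ne fun h => hm.2 ?_
      rw [huniq m ⟨hm.1, h.symm⟩]
      exact mem_ball_self hδ
    filter_upwards [(continuous_infDist_pt M).continuousAt.eventually_lt
      (continuous_infDist_pt K).continuousAt hgap] with y hy q hq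
    refine lt_of_not_ge fun h => hy.not_ge ?_
    exact hq.dist_eq ▸ infDist_le_dist_of_mem (mem_K hq.mem h)

end NearestPoints

section DistanceGrowth

variable {E : Type*} [NormedAddCommGroup E] [InnerProductSpace ℝ E]

theorem add_mul_lt_norm_add_smul {u v : E} {κ ε : ℝ} (hv : v ≠ 0) (huv : ‖v‖ ≤ ‖u‖)
    (hκ : 0 ≤ κ) (hclose : ‖v - u‖ < (1 - κ) * ‖v‖) (hε : 0 < ε) :
    ‖v‖ + κ * (ε * ‖v‖) < ‖u + ε • v‖ := by
  have hv' : 0 < ‖v‖ := norm_pos_iff.2 hv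
  have hinner : κ * ‖v‖ ^ 2 < inner ℝ u v := by
    have h₁ : inner ℝ (v - u) v ≤ ‖v - u‖ * ‖v‖ := real_inner_le_norm _ _
    rw [inner_sub_left, real_inner_self_eq_norm_sq] at h₁
    nlinarith
  have hκ' : κ ^ 2 ≤ 1 := by
    have : 0 < 1 - κ := pos_of_mul_pos_left ((norm_nonneg _).trans_lt hclose) hv'.le
    nlinarith
  have huv₂ : ‖v‖ ^ 2 ≤ ‖u‖ ^ 2 := by gcongr
  refine lt_of_pow_lt_pow_left₀ 2 (norm_nonneg _) ?_
  calc (‖v‖ + κ * (ε * ‖v‖)) ^ 2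
      = ‖v‖ ^ 2 + 2 * (ε * (κ * ‖v‖ ^ 2)) + κ ^ 2 * (ε * ‖v‖) ^ 2 := by ring
    _ < ‖v‖ ^ 2 + 2 * (ε * inner ℝ u v) + κ ^ 2 * (ε * ‖v‖) ^ 2 := by gcongr
    _ ≤ ‖u‖ ^ 2 + 2 * (ε * inner ℝ u v) + 1 * (ε * ‖v‖) ^ 2 := by gcongr
    _ = ‖u + ε • v‖ ^ 2 := by
        rw [norm_add_sq_real, inner_smul_right, norm_smul, Real.norm_of_nonneg hε.le, one_mul]

variable [ProperSpace E] {M : Set E} {R : ℝ}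

theorem frequently_infDist_add_mul_dist_lt (hM : IsClosed M) {x p : E} (hp : IsNearestPoint M x p)
    (huniq : ∀ q, IsNearestPoint M x q → q = p) (hx : 0 < infDist x M) {κ : ℝ} (hκ : 0 ≤ κ)
    (hκ₁ : κ < 1) : ∃ᶠ y in 𝓝 x, infDist x M + κ * dist y x < infDist y M := by
  have hxp : ‖x - p‖ = infDist x M := by rw [← dist_eq_norm, hp.dist_eq]
  have htendsto : Tendsto (fun ε : ℝ => x + ε • (x - p)) (𝓝[>] 0) (𝓝 x) := by
    have : Continuous fun ε : ℝ => x + ε • (x - p) := by fun_prop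
    simpa using (this.tendsto 0).mono_left nhdsWithin_le_nhds
  refine htendsto.frequently (Eventually.frequently ?_)
  filter_upwards [self_mem_nhdsWithin, htendsto.eventually
    (eventually_isNearestPoint_dist_lt hM huniq (mul_pos (sub_pos.2 hκ₁) hx))] with ε hε hclose
  obtain ⟨q, hq⟩ := exists_isNearestPoint hM ⟨p, hp.mem⟩ (x + ε • (x - p))
  have hxq : ‖x - p‖ ≤ ‖x - q‖ := by
    rw [hxp, ← dist_eq_norm]
    exact infDist_le_dist_of_mem hq.mem
  have hqp : ‖x - p - (x - q)‖ < (1 - κ) * ‖x - p‖ := by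
    rw [sub_sub_sub_cancel_left, ← dist_eq_norm, hxp]
    exact hclose q hq
  rw [← hq.dist_eq, dist_eq_norm, dist_eq_norm, add_sub_cancel_left, norm_smul,
    Real.norm_of_nonneg (le_of_lt hε), ← hxp, add_sub_right_comm]
  exact add_mul_lt_norm_add_smul (norm_pos_iff.1 (hxp ▸ hx)) hxq hκ hqp hε

theorem HasUniqueNearestPoints.exists_dist_eq_add_mul_le_infDist (hM : IsClosed M)
    (hR : HasUniqueNearestPoints M R) {x : E} {s : ℝ} (hx : 0 < infDist x M) (hs : 0 ≤ s)
    (hsR : infDist x M + s ≤ R) {κ : ℝ} (hκ : 0 ≤ κ) (hκ₁ : κ < 1) :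
    ∃ y, dist y x = s ∧ infDist x M + κ * s ≤ infDist y M := by
  have hne : M.Nonempty := Set.nonempty_iff_ne_empty.2 fun h => by simp [h] at hx
  -- By `frequently_infDist_add_mul_dist_lt`, a maximizer cannot lie in the open ball.
  obtain ⟨y, hy, hmax⟩ := (isCompact_closedBall x s).exists_isMaxOn ⟨x, mem_closedBall_self hs⟩
    (f := fun y => infDist y M - κ * dist y x) (by fun_prop)
  have hxy : infDist x M + κ * dist y x ≤ infDist y M := by
    have := isMaxOn_iff.1 hmax x (mem_closedBall_self hs)
    simp only [dist_self] at this
    linarith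
  suffices hys : dist y x = s from ⟨y, hys, hys ▸ hxy⟩
  by_contra hys
  have hlt : dist y x < s := lt_of_le_of_ne hy hys
  have hyR : infDist y M < R := by
    have : infDist y M ≤ infDist x M + dist y x := infDist_le_infDist_add_dist
    linarith
  obtain ⟨p, hp⟩ := exists_isNearestPoint hM hne y
  have hgrowth := frequently_infDist_add_mul_dist_lt hM hp (fun q hq => hR hyR hq hp)
    (hx.trans_le (le_of_add_le_of_nonneg_left hxy (by positivity))) hκ hκ₁
  obtain ⟨z, hz, hzx⟩ := (hgrowth.and_eventually (isOpen_ball.mem_nhds hlt)).exists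
  have hzy : infDist z M - κ * dist z x ≤ infDist y M - κ * dist y x :=
    isMaxOn_iff.1 hmax z (ball_subset_closedBall hzx)
  nlinarith [dist_triangle z y x]

theorem HasUniqueNearestPoints.exists_dist_eq_add_le_infDist (hM : IsClosed M)
    (hR : HasUniqueNearestPoints M R) {x : E} {s : ℝ} (hx : 0 < infDist x M) (hs : 0 ≤ s)
    (hsR : infDist x M + s ≤ R) : ∃ y, dist y x = s ∧ infDist x M + s ≤ infDist y M := by
  have happrox := fun κ => hR.exists_dist_eq_add_mul_le_infDist (κ := κ) hM hx hs hsR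
  obtain ⟨y₀, hy₀, -⟩ := happrox 0 le_rfl one_pos
  obtain ⟨y, hy, hmax⟩ := (isCompact_sphere x s).exists_isMaxOn ⟨y₀, hy₀⟩
    (f := fun y => infDist y M) (by fun_prop)
  refine ⟨y, hy, ?_⟩
  have hle : ∀ᶠ κ : ℝ in 𝓝[<] 1, infDist x M + κ * s ≤ infDist y M := by
    filter_upwards [Ico_mem_nhdsLT zero_lt_one] with κ hκ
    obtain ⟨w, hw, hwM⟩ := happrox κ hκ.1 hκ.2
    exact hwM.trans (isMaxOn_iff.1 hmax w hw)
  have hlim : Tendsto (fun κ : ℝ => infDist x M + κ * s) (𝓝[<] 1) (𝓝 (infDist x M + 1 * s)) :=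
    ((continuous_const.add (continuous_id.mul continuous_const)).tendsto 1).mono_left
      nhdsWithin_le_nhds
  simpa using le_of_tendsto hlim hle

end DistanceGrowth

section MidpointProjection

variable {E : Type*} [NormedAddCommGroup E] [InnerProductSpace ℝ E] [ProperSpace E] {M : Set E}
  {R : ℝ} {a b z : E}

theorem HasUniqueNearestPoints.sq_le_sub_infDist_midpoint_sq_add (hM : IsClosed M)
    (hR : HasUniqueNearestPoints M R) (ha : a ∈ M) (hb : b ∈ M)
    (hmid : infDist (midpoint ℝ a b) M ≤ R) :
    R ^ 2 ≤ (R - infDist (midpoint ℝ a b) M) ^ 2 + (dist a b / 2) ^ 2 := by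
  set c := midpoint ℝ a b
  rcases (infDist_nonneg (x := c) (s := M)).eq_or_lt' with hc | hc
  · rw [hc, sub_zero]
    exact le_add_of_nonneg_right (sq_nonneg _)
  · obtain ⟨y, hyc, hy⟩ := hR.exists_dist_eq_add_le_infDist (x := c) (s := R - infDist c M) hM hc
      (sub_nonneg.2 hmid) (by linarith)
    rw [add_sub_cancel] at hy
    have hya : R ≤ dist y a := hy.trans (infDist_le_dist_of_mem ha)
    have hyb : R ≤ dist y b := hy.trans (infDist_le_dist_of_mem hb)
    have hmedian :=
      EuclideanGeometry.dist_sq_add_dist_sq_eq_two_mul_dist_midpoint_sq_add_half_dist_sq y a b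
    have hR₀ : 0 ≤ R := infDist_nonneg.trans hmid
    rw [← hyc]
    linarith [pow_le_pow_left₀ hR₀ hya 2, pow_le_pow_left₀ hR₀ hyb 2]

theorem HasUniqueNearestPoints.dist_midpoint_add_infDist_le (hM : IsClosed M)
    (hR : HasUniqueNearestPoints M R) (ha : a ∈ M) (hb : b ∈ M) (haz : dist a z = R)
    (hbz : dist b z = R) : dist (midpoint ℝ a b) z + infDist (midpoint ℝ a b) M ≤ R := by
  set c := midpoint ℝ a b
  have hmedian : R ^ 2 = dist c z ^ 2 + (dist a b / 2) ^ 2 := by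
    have :=
      EuclideanGeometry.dist_sq_add_dist_sq_eq_two_mul_dist_midpoint_sq_add_half_dist_sq z a b
    rw [dist_comm z a, haz, dist_comm z b, hbz, dist_comm z] at this
    linarith
  have hcR : infDist c M ≤ R := by
    have hca : dist c a = dist a b / 2 := by
      rw [dist_midpoint_left, Real.norm_ofNat, inv_mul_eq_div]
    refine (infDist_le_dist_of_mem ha).trans (abs_le_of_sq_le_sq' ?_ (haz ▸ dist_nonneg)).2
    rw [hca]
    nlinarith [sq_nonneg (dist c z)]
  have hsq := hR.sq_le_sub_infDist_midpoint_sq_add hM ha hb hcR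
  exact le_sub_iff_add_le.1 (abs_le_of_sq_le_sq' (by linarith) (sub_nonneg.2 hcR)).2

theorem HasUniqueNearestPoints.mem_of_sameRay_midpoint_sub (hM : IsClosed M)
    (hR : HasUniqueNearestPoints M R) (hz : ∀ p ∈ M, R ≤ dist p z) (ha : a ∈ M) (hb : b ∈ M)
    (haz : dist a z = R) (hbz : dist b z = R) (hmid : midpoint ℝ a b ≠ z) {w : E}
    (hw : SameRay ℝ (midpoint ℝ a b - z) (w - z)) (hwz : dist w z = R) : w ∈ M := by
  have hle := hR.dist_midpoint_add_infDist_le hM ha hb haz hbz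
  set c := midpoint ℝ a b
  obtain ⟨p, hp⟩ := exists_isNearestPoint hM ⟨a, ha⟩ c
  rw [← hp.dist_eq, add_comm, dist_comm c p] at hle
  have hpz : dist p z = R := ((dist_triangle p c z).trans hle).antisymm (hz p hp.mem)
  have hray : SameRay ℝ (c - z) (p - z) := by
    have : SameRay ℝ (p - c) (c - z) := by
      rw [sameRay_iff_norm_add, sub_add_sub_cancel]
      simp only [← dist_eq_norm]
      exact le_antisymm (dist_triangle _ _ _) (hpz ▸ hle)
    simpa using this.symm.add_right (SameRay.refl (c - z))
  have hwp : SameRay ℝ (w - z) (p - z) :=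
    hw.symm.trans hray fun h => absurd (sub_eq_zero.1 h) hmid
  have : w - z = p - z := hwp.eq_of_norm_eq (by rw [← dist_eq_norm, ← dist_eq_norm, hwz, hpz])
  exact sub_left_injective this ▸ hp.mem

end MidpointProjection

theorem Icc_subset_of_midpoint_mem {S : Set ℝ} (hS : IsClosed S)
    (hmid : ∀ s ∈ S, ∀ t ∈ S, s < t → (s + t) / 2 ∈ S) {a b : ℝ} (ha : a ∈ S) (hb : b ∈ S) :
    Icc a b ⊆ S := by
  intro t ht
  obtain ⟨⟨hlS, hlt⟩, hl⟩ := (hS.inter (isClosed_Iic (a := t))).isGreatest_csSup ⟨a, ha, ht.1⟩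
    (bddAbove_Iic.mono inter_subset_right)
  obtain ⟨⟨hrS, htr⟩, hr⟩ := (hS.inter (isClosed_Ici (a := t))).isLeast_csInf ⟨b, hb, ht.2⟩
    (bddBelow_Ici.mono inter_subset_right)
  set l := sSup (S ∩ Iic t)
  set r := sInf (S ∩ Ici t)
  rw [mem_Iic] at hlt
  rw [mem_Ici] at htr
  rcases eq_or_lt_of_le (hlt.trans htr) with hlr | hlr
  · rwa [le_antisymm (hlr ▸ htr) hlt]
  · have hm := hmid l hlS r hrS hlr
    rcases le_total ((l + r) / 2) t with hmt | hmt
    · exact absurd (hl ⟨hm, hmt⟩) (left_lt_add_div_two.2 hlr).not_ge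
    · exact absurd (hr ⟨hm, hmt⟩) (add_div_two_lt_right.2 hlr).not_ge

section Slerp

variable {E : Type*} [NormedAddCommGroup E] [InnerProductSpace ℝ E] {x y : E} {R : ℝ}

/-- Spherical linear interpolation: for `‖x‖ = ‖y‖`, the vector at angle `s` from `x` on the great
circle through `x` and `y`, so that `y` is reached at `s = angle x y`. Junk value if
`sin (angle x y) = 0`, where the great circle is not determined. -/
noncomputable def slerp (x y : E) (s : ℝ) : E :=
  (sin (angle x y - s) / sin (angle x y)) • x + (sin s / sin (angle x y)) • y

theorem slerp_zero (h : sin (angle x y) ≠ 0) : slerp x y 0 = x := by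
  simp [slerp, h]

theorem slerp_angle (h : sin (angle x y) ≠ 0) : slerp x y (angle x y) = y := by
  simp [slerp, h]

theorem contDiff_slerp (x y : E) : ContDiff ℝ ∞ (slerp x y) := by
  unfold slerp
  fun_prop

theorem hasDerivAt_slerp (x y : E) (s : ℝ) :
    HasDerivAt (slerp x y) (slerp x y (s + π / 2)) s := by
  have hx : HasDerivAt (fun s => sin (angle x y - s)) (sin (angle x y - (s + π / 2))) s := by
    simpa [← sub_sub, sin_sub_pi_div_two] using ((hasDerivAt_id s).const_sub (angle x y)).sin
  have hy : HasDerivAt sin (sin (s + π / 2)) s := by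
    simpa [sin_add_pi_div_two] using hasDerivAt_sin s
  exact ((hx.div_const _).smul_const x).add ((hy.div_const _).smul_const y)

theorem inner_slerp_slerp (hx : ‖x‖ = R) (hy : ‖y‖ = R) (h : sin (angle x y) ≠ 0) (s t : ℝ) :
    inner ℝ (slerp x y s) (slerp x y t) = R ^ 2 * cos (s - t) := by
  have hxy : inner ℝ x y = R ^ 2 * cos (angle x y) := by
    rw [← cos_angle_mul_norm_mul_norm, hx, hy]
    ring
  simp only [slerp, inner_add_left, inner_add_right, inner_smul_left, inner_smul_right,
    real_inner_self_eq_norm_sq, real_inner_comm x y, hxy, hx, hy, sin_sub, cos_sub,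
    conj_trivial]
  field_simp
  have := sin_sq_add_cos_sq (angle x y)
  grind

theorem norm_slerp (hx : ‖x‖ = R) (hy : ‖y‖ = R) (h : sin (angle x y) ≠ 0) (s : ℝ) :
    ‖slerp x y s‖ = R := by
  have hsq : ‖slerp x y s‖ ^ 2 = R ^ 2 := by
    rw [← real_inner_self_eq_norm_sq, inner_slerp_slerp hx hy h, sub_self, cos_zero, mul_one]
  exact (sq_eq_sq₀ (norm_nonneg _) (hx ▸ norm_nonneg x)).1 hsq

theorem slerp_add_slerp (x y : E) (s t : ℝ) :
    slerp x y s + slerp x y t = (2 * cos ((s - t) / 2)) • slerp x y ((s + t) / 2) := by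
  have hx : sin (angle x y - s) + sin (angle x y - t)
      = 2 * cos ((s - t) / 2) * sin (angle x y - (s + t) / 2) := by
    rw [sin_add_sin, show (angle x y - s - (angle x y - t)) / 2 = -((s - t) / 2) by ring, cos_neg,
      show (angle x y - s + (angle x y - t)) / 2 = angle x y - (s + t) / 2 by ring]
    ring
  have hy : sin s + sin t = 2 * cos ((s - t) / 2) * sin ((s + t) / 2) := by
    rw [sin_add_sin]
    ring
  simp only [slerp, smul_add, smul_smul, ← mul_div_assoc, ← hx, ← hy]
  module

theorem eq_slerp_of_angle_eq {u : E} {s : ℝ} (hx : ‖x‖ = R) (hy : ‖y‖ = R) (hu : ‖u‖ = R)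
    (h : sin (angle x y) ≠ 0) (hxu : angle x u = s) (huy : angle u y = angle x y - s) :
    u = slerp x y s := by
  have hux : inner ℝ u x = R ^ 2 * cos s := by
    rw [← cos_angle_mul_norm_mul_norm, angle_comm, hxu, hu, hx]
    ring
  have huy' : inner ℝ u y = R ^ 2 * cos (angle x y - s) := by
    rw [← cos_angle_mul_norm_mul_norm, huy, hu, hy]
    ring
  have hinner : inner ℝ u (slerp x y s) = R ^ 2 := by
    rw [slerp, inner_add_right, inner_smul_right, inner_smul_right, hux, huy', sin_sub, cos_sub]
    field_simp
    linear_combination R ^ 2 * sin (angle x y) * sin_sq_add_cos_sq s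
  have hsq : ‖u - slerp x y s‖ ^ 2 = 0 := by
    rw [norm_sub_sq_real, hinner, hu, norm_slerp hx hy h]
    ring
  exact sub_eq_zero.1 (norm_eq_zero.1 (pow_eq_zero_iff two_ne_zero |>.1 hsq))

theorem image_slerp_Icc (hR : 0 < R) (hx : ‖x‖ = R) (hy : ‖y‖ = R) (h : sin (angle x y) ≠ 0) :
    slerp x y '' Icc 0 (angle x y) =
      {u | ‖u‖ = R ∧ ∃ a b : ℝ, 0 ≤ a ∧ 0 ≤ b ∧ u = a • x + b • y} := by
  have hsin : ∀ s, 0 ≤ s → s ≤ angle x y → 0 ≤ sin s / sin (angle x y) := fun s hs hs' =>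
    div_nonneg (sin_nonneg_of_nonneg_of_le_pi hs (hs'.trans (angle_le_pi x y)))
      (sin_angle_nonneg x y)
  refine Subset.antisymm ?_ ?_
  · rintro _ ⟨s, hs, rfl⟩
    exact ⟨norm_slerp hx hy h s, _, _, hsin _ (sub_nonneg.2 hs.2) (sub_le_self _ hs.1),
      hsin s hs.1 hs.2, rfl⟩
  · rintro u ⟨hu, a, b, ha, hb, huab⟩
    have hspan : u ∈ Submodule.span NNReal {x, y} :=
      Submodule.mem_span_pair.2 ⟨⟨a, ha⟩, ⟨b, hb⟩, huab.symm⟩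
    have hadd : angle x y = angle x u + angle u y :=
      (angle_eq_angle_add_angle_iff (norm_pos_iff.1 (hu ▸ hR))).2 (Or.inr hspan)
    have huy : angle u y = angle x y - angle x u := by rw [hadd, add_sub_cancel_left]
    refine ⟨angle x u, ⟨angle_nonneg _ _, ?_⟩, (eq_slerp_of_angle_eq hx hy hu h rfl huy).symm⟩
    exact sub_nonneg.1 (huy ▸ angle_nonneg _ _)

theorem HasUniqueNearestPoints.add_slerp_mem [ProperSpace E] {M : Set E} {z : E}
    (hM : IsClosed M) (hunique : HasUniqueNearestPoints M R) (hz : ∀ p ∈ M, R ≤ dist p z)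
    (hR : 0 < R) (hx : ‖x‖ = R) (hy : ‖y‖ = R) (h : sin (angle x y) ≠ 0) (hzx : z + x ∈ M)
    (hzy : z + y ∈ M) {s : ℝ} (hs : s ∈ Icc 0 (angle x y)) : z + slerp x y s ∈ M := by
  have hdist : ∀ s, dist (z + slerp x y s) z = R := fun s => by
    rw [dist_self_add_left, norm_slerp hx hy h]
  have hclosed : IsClosed (Icc 0 (angle x y) ∩ (fun s => z + slerp x y s) ⁻¹' M) :=
    isClosed_Icc.inter (hM.preimage (continuous_const.add (contDiff_slerp x y).continuous))
  refine (Icc_subset_of_midpoint_mem hclosed ?_ ⟨left_mem_Icc.2 (angle_nonneg x y), ?_⟩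
    ⟨right_mem_Icc.2 (angle_nonneg x y), ?_⟩ hs).2
  · rintro s ⟨hs, hsM⟩ t ⟨ht, htM⟩ hst
    have hangle : angle x y < π := (angle_le_pi x y).lt_of_ne fun hπ => h (by rw [hπ, sin_pi])
    have hcos : 0 < cos ((s - t) / 2) :=
      cos_pos_of_mem_Ioo ⟨by linarith [hs.1, ht.2], by linarith [pi_pos]⟩
    have hmid : midpoint ℝ (z + slerp x y s) (z + slerp x y t) - z
        = cos ((s - t) / 2) • slerp x y ((s + t) / 2) := by
      rw [midpoint_eq_smul_add, add_add_add_comm, slerp_add_slerp, invOf_eq_inv]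
      module
    refine ⟨⟨by linarith [hs.1, ht.1], by linarith [hs.2, ht.2]⟩, ?_⟩
    refine hunique.mem_of_sameRay_midpoint_sub hM hz hsM htM (hdist s) (hdist t) ?_ ?_ (hdist _)
    · rw [← sub_ne_zero, hmid]
      exact smul_ne_zero hcos.ne' (norm_pos_iff.1 (norm_slerp hx hy h _ ▸ hR))
    · rw [hmid, add_sub_cancel_left]
      exact (SameRay.refl _).pos_smul_left hcos
  · rwa [mem_preimage, slerp_zero h]
  · rwa [mem_preimage, slerp_angle h]

end Slerp

section CircularArc

variable {E : Type*} [NormedAddCommGroup E] [InnerProductSpace ℝ E] {z p q : E} {R : ℝ}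

/-- For `p` and `q` on the sphere of centre `z` and radius `R`, the parametrization by arc length,
starting from `p`, of the great circle of this sphere through `p` and `q`. -/
noncomputable def circularArc (z p q : E) (R t : ℝ) : E :=
  z + slerp (p - z) (q - z) (t / R)

theorem circularArc_zero (h : sin (∠ p z q) ≠ 0) : circularArc z p q R 0 = p := by
  rw [circularArc, zero_div]
  exact (congrArg (z + ·) (slerp_zero h)).trans (add_sub_cancel z p)

theorem circularArc_mul_angle (hR : R ≠ 0) (h : sin (∠ p z q) ≠ 0) :
    circularArc z p q R (R * ∠ p z q) = q := by
  rw [circularArc, mul_div_cancel_left₀ _ hR]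
  exact (congrArg (z + ·) (slerp_angle h)).trans (add_sub_cancel z q)

theorem contDiff_circularArc (z p q : E) (R : ℝ) : ContDiff ℝ ∞ (circularArc z p q R) :=
  contDiff_const.add ((contDiff_slerp _ _).comp (contDiff_id.div_const R))

theorem deriv_circularArc (z p q : E) (R t : ℝ) :
    deriv (circularArc z p q R) t = R⁻¹ • slerp (p - z) (q - z) (t / R + π / 2) := by
  have := (hasDerivAt_slerp (p - z) (q - z) (t / R)).scomp t ((hasDerivAt_id t).div_const R)
  rw [← one_div]
  exact (this.const_add z).deriv

theorem deriv_deriv_circularArc (z p q : E) (R t : ℝ) :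
    deriv (deriv (circularArc z p q R)) t =
      R⁻¹ • R⁻¹ • slerp (p - z) (q - z) (t / R + π / 2 + π / 2) := by
  have := (hasDerivAt_slerp (p - z) (q - z) (t / R + π / 2)).scomp t
    (((hasDerivAt_id t).div_const R).add_const (π / 2))
  rw [funext (deriv_circularArc z p q R), ← one_div]
  exact (this.const_smul (1 / R)).deriv

theorem norm_deriv_circularArc (hR : 0 < R) (hp : dist p z = R) (hq : dist q z = R)
    (h : sin (∠ p z q) ≠ 0) (t : ℝ) : ‖deriv (circularArc z p q R) t‖ = 1 := by
  rw [dist_eq_norm] at hp hq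
  rw [deriv_circularArc, norm_smul, norm_slerp hp hq h, norm_inv, Real.norm_of_nonneg hR.le,
    inv_mul_cancel₀ hR.ne']

theorem norm_deriv_deriv_circularArc (hR : 0 < R) (hp : dist p z = R) (hq : dist q z = R)
    (h : sin (∠ p z q) ≠ 0) (t : ℝ) : ‖deriv (deriv (circularArc z p q R)) t‖ = 1 / R := by
  rw [dist_eq_norm] at hp hq
  rw [deriv_deriv_circularArc, norm_smul, norm_smul, norm_slerp hp hq h, norm_inv,
    Real.norm_of_nonneg hR.le, inv_mul_cancel₀ hR.ne', mul_one, one_div]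

theorem sin_angle_ne_zero_of_dist_lt (hp : dist p z = R) (hq : dist q z = R) (hpq : p ≠ q)
    (hlt : dist p q < 2 * R) : sin (∠ p z q) ≠ 0 := by
  rw [dist_eq_norm] at hp hq
  rw [dist_eq_norm, ← sub_sub_sub_cancel_right p q z] at hlt
  refine fun h => (sin_eq_zero_iff_angle_eq_zero_or_angle_eq_pi.1 h).elim (fun h₀ => hpq ?_)
    fun hπ => hlt.ne ?_
  · have := norm_sub_eq_abs_sub_norm_of_angle_eq_zero h₀
    rwa [vsub_eq_sub, vsub_eq_sub, hp, hq, sub_self, abs_zero, norm_eq_zero,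
      sub_sub_sub_cancel_right, sub_eq_zero] at this
  · have := norm_sub_eq_add_norm_of_angle_eq_pi hπ
    rwa [vsub_eq_sub, vsub_eq_sub, hp, hq, ← two_mul] at this

theorem angle_pos_of_sin_angle_ne_zero (h : sin (∠ p z q) ≠ 0) : 0 < ∠ p z q :=
  (EuclideanGeometry.angle_nonneg p z q).lt_of_ne fun h₀ => h (by rw [← h₀, sin_zero])

theorem HasUniqueNearestPoints.circularArc_mem [ProperSpace E] {M : Set E} (hM : IsClosed M)
    (hunique : HasUniqueNearestPoints M R) (hz : ∀ p ∈ M, R ≤ dist p z) (hR : 0 < R)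
    (hp : dist p z = R) (hq : dist q z = R) (h : sin (∠ p z q) ≠ 0) (hpM : p ∈ M) (hqM : q ∈ M)
    {t : ℝ} (ht : t ∈ Icc 0 (R * ∠ p z q)) : circularArc z p q R t ∈ M := by
  rw [dist_eq_norm] at hp hq
  exact hunique.add_slerp_mem hM hz hR hp hq h (by rwa [add_sub_cancel]) (by rwa [add_sub_cancel])
    ⟨div_nonneg ht.1 hR.le, (div_le_iff₀' hR).2 ht.2⟩

end CircularArc

section Calculus

variable {E : Type*} [NormedAddCommGroup E] [NormedSpace ℝ E] {x x' : ℝ → E} {a b : ℝ}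

theorem hasDerivWithinAt_integral_Ici {f : ℝ → ℝ} (hf : ContinuousOn f (Icc a b)) {t : ℝ}
    (ht : t ∈ Ico a b) :
    HasDerivWithinAt (fun u => ∫ s in a..u, f s) (f t) (Ici t) t := by
  have hIcc : Icc a b ∈ 𝓝[>] t := mem_of_superset (Ioo_mem_nhdsGT ht.2) fun s hs =>
    ⟨ht.1.trans hs.1.le, hs.2.le⟩
  refine intervalIntegral.integral_hasDerivWithinAt_right
    ((hf.mono (Icc_subset_Icc_right ht.2.le)).intervalIntegrable_of_Icc ht.1) ?_ ?_
  · exact ⟨Icc a b, hIcc, hf.aestronglyMeasurable measurableSet_Icc⟩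
  · exact (hf t (Ico_subset_Icc_self ht)).mono_of_mem_nhdsWithin hIcc

theorem continuousOn_integral_Icc {f : ℝ → ℝ} (hab : a ≤ b) (hf : ContinuousOn f (Icc a b)) :
    ContinuousOn (fun u => ∫ s in a..u, f s) (Icc a b) :=
  (intervalIntegral.continuousOn_primitive_interval' (hf.intervalIntegrable_of_Icc hab)
    left_mem_uIcc).mono Icc_subset_uIcc

theorem image_integral_Icc {f : ℝ → ℝ} (hab : a ≤ b) (hf : ContinuousOn f (Icc a b))
    (hf₀ : ∀ t, 0 ≤ f t) :
    (fun t => ∫ s in a..t, f s) '' Icc a b = Icc 0 (∫ s in a..b, f s) := by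
  refine Subset.antisymm ?_ ?_
  · rintro _ ⟨t, ht, rfl⟩
    exact ⟨intervalIntegral.integral_nonneg ht.1 fun _ _ => hf₀ _,
      intervalIntegral.integral_mono_interval le_rfl ht.1 ht.2 (Eventually.of_forall hf₀)
        (hf.intervalIntegrable_of_Icc hab)⟩
  · simpa using intermediate_value_Icc hab (continuousOn_integral_Icc hab hf)

theorem hasDerivWithinAt_norm_sub_Ici {v : E} {t : ℝ} (hx : HasDerivWithinAt x v (Ici t) t) :
    HasDerivWithinAt (fun z => ‖x z - x t‖) ‖v‖ (Ici t) t := by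
  rw [hasDerivWithinAt_iff_tendsto_slope, Ici_sdiff_left] at hx ⊢
  refine hx.norm.congr' ?_
  filter_upwards [self_mem_nhdsWithin] with z hz
  rw [slope_def_module, slope_def_field, norm_smul, norm_inv,
    Real.norm_of_nonneg (sub_nonneg.2 (le_of_lt hz)), sub_self, norm_zero, sub_zero,
    inv_mul_eq_div]

theorem exists_eq_forall_Icc_le_of_continuousOn {f : ℝ → ℝ} {y : ℝ} (hab : a ≤ b)
    (hf : ContinuousOn f (Icc a b)) (ha : f a ≤ y) (hb : y ≤ f b) :
    ∃ s ∈ Icc a b, f s = y ∧ ∀ u ∈ Icc s b, y ≤ f u := by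
  obtain ⟨s₀, hs₀, hfs₀⟩ := intermediate_value_Icc hab hf ⟨ha, hb⟩
  have hcompact : IsCompact (Icc a b ∩ f ⁻¹' {y}) :=
    isCompact_Icc.of_isClosed_subset (hf.preimage_isClosed_of_isClosed isClosed_Icc
      isClosed_singleton) inter_subset_left
  obtain ⟨s, ⟨hs, hfs⟩, hmax⟩ := hcompact.exists_isGreatest ⟨s₀, hs₀, hfs₀⟩
  refine ⟨s, hs, hfs, fun u hu => ?_⟩
  by_contra! hlt
  have hau : a ≤ u := hs.1.trans hu.1
  obtain ⟨v, hv, hfv⟩ := intermediate_value_Icc hu.2 (hf.mono (Icc_subset_Icc_left hau))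
    ⟨hlt.le, hb⟩
  have hvs : v ≤ s := hmax ⟨⟨hau.trans hv.1, hv.2⟩, hfv⟩
  have huv : u = v := hv.1.antisymm (hvs.trans hu.1)
  exact hlt.ne (huv ▸ hfv)

/-- The function `x` is continuously differentiable on `s` with derivative `x'` there. Carrying the
derivative along allows restricting to smaller sets, as `derivWithin` does not. -/
structure HasContinuousDerivOn (x x' : ℝ → E) (s : Set ℝ) : Prop where
  hasDerivWithinAt : ∀ t ∈ s, HasDerivWithinAt x (x' t) s t
  continuousOn_deriv : ContinuousOn x' s

namespace HasContinuousDerivOn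

variable {s : Set ℝ}

theorem mono (hx : HasContinuousDerivOn x x' s) {u : Set ℝ} (hu : u ⊆ s) :
    HasContinuousDerivOn x x' u :=
  ⟨fun t ht => (hx.hasDerivWithinAt t (hu ht)).mono hu, hx.continuousOn_deriv.mono hu⟩

theorem continuousOn (hx : HasContinuousDerivOn x x' s) : ContinuousOn x s :=
  fun t ht => (hx.hasDerivWithinAt t ht).continuousWithinAt

theorem hasDerivWithinAt_Ici (hx : HasContinuousDerivOn x x' (Icc a b)) {t : ℝ}
    (ht : t ∈ Ico a b) : HasDerivWithinAt x (x' t) (Ici t) t :=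
  (hx.hasDerivWithinAt t (Ico_subset_Icc_self ht)).mono_of_mem_nhdsWithin
    (mem_of_superset (Icc_mem_nhdsGE ht.2) (Icc_subset_Icc_left ht.1))

theorem norm_sub_le_integral (hx : HasContinuousDerivOn x x' (Icc a b)) (hab : a ≤ b) :
    ‖x b - x a‖ ≤ ∫ t in a..b, ‖x' t‖ :=
  image_norm_le_of_norm_deriv_right_le_deriv_boundary' (f := fun t => x t - x a)
    (hx.continuousOn.sub continuousOn_const)
    (fun _ ht => (hx.hasDerivWithinAt_Ici ht).sub_const _) (by simp)
    (continuousOn_integral_Icc hab hx.continuousOn_deriv.norm)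
    (fun _ ht => hasDerivWithinAt_integral_Ici hx.continuousOn_deriv.norm ht)
    (fun _ _ => le_rfl) (right_mem_Icc.2 hab)

theorem integral_add_integral (hx : HasContinuousDerivOn x x' (Icc a b)) {t : ℝ}
    (ht : t ∈ Icc a b) :
    (∫ s in a..t, ‖x' s‖) + ∫ s in t..b, ‖x' s‖ = ∫ s in a..b, ‖x' s‖ :=
  intervalIntegral.integral_add_adjacent_intervals
    ((hx.mono (Icc_subset_Icc_right ht.2)).continuousOn_deriv.norm.intervalIntegrable_of_Icc ht.1)
    ((hx.mono (Icc_subset_Icc_left ht.1)).continuousOn_deriv.norm.intervalIntegrable_of_Icc ht.2)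

end HasContinuousDerivOn

end Calculus

section OutsideBall

variable {E : Type*} [NormedAddCommGroup E] [InnerProductSpace ℝ E] {x x' : ℝ → E} {R a b : ℝ}

theorem angle_le_two_mul_arcsin {u v : E} (hR : 0 < R) (hu : R ≤ ‖u‖) (hv : R ≤ ‖v‖) :
    angle u v ≤ 2 * arcsin (‖v - u‖ / (2 * R)) := by
  have hsin : 0 ≤ sin (angle u v / 2) :=
    sin_nonneg_of_nonneg_of_le_pi (by linarith [angle_nonneg u v])
      (by linarith [angle_le_pi u v, pi_pos])
  have hcos : cos (angle u v) = 1 - 2 * sin (angle u v / 2) ^ 2 := by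
    rw [← cos_two_mul_eq_one_sub, mul_div_cancel₀ _ two_ne_zero]
  have hchord : (2 * R * sin (angle u v / 2)) ^ 2 ≤ ‖v - u‖ ^ 2 := by
    have hRR : R * R ≤ ‖u‖ * ‖v‖ := mul_le_mul hu hv hR.le (norm_nonneg u)
    have hlaw := norm_sub_sq_eq_norm_sq_add_norm_sq_sub_two_mul_norm_mul_norm_mul_cos_angle u v
    rw [hcos, norm_sub_rev] at hlaw
    have := mul_le_mul_of_nonneg_right hRR (sq_nonneg (sin (angle u v / 2)))
    linarith [sq_nonneg (‖u‖ - ‖v‖)]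
  have hle : sin (angle u v / 2) ≤ ‖v - u‖ / (2 * R) := by
    rw [le_div_iff₀' (by positivity)]
    exact (sq_le_sq₀ (by positivity) (norm_nonneg _)).1 hchord
  have := (arcsin_sin (by linarith [pi_pos, angle_nonneg u v])
    (by linarith [angle_le_pi u v])).ge.trans (monotone_arcsin hle)
  linarith

namespace HasContinuousDerivOn

theorem frequently_slope_angle_lt (hx : HasContinuousDerivOn x x' (Icc a b)) (hR : 0 < R)
    (hout : ∀ t ∈ Icc a b, R ≤ ‖x t‖) (v : E) {t r : ℝ} (ht : t ∈ Ico a b) (hr : ‖x' t‖ / R < r) :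
    ∃ᶠ z in 𝓝[>] t, slope (fun s => angle v (x s)) t z < r := by
  have harcsin : HasDerivAt arcsin 1 (‖x t - x t‖ / (2 * R)) := by
    simpa using hasDerivAt_arcsin (x := 0) (by norm_num) (by norm_num)
  have hnorm := hasDerivWithinAt_norm_sub_Ici (hx.hasDerivWithinAt_Ici ht)
  have hchord : HasDerivWithinAt (fun z => 2 * arcsin (‖x z - x t‖ / (2 * R))) (‖x' t‖ / R)
      (Ici t) t := by
    refine ((harcsin.comp_hasDerivWithinAt t (hnorm.div_const (2 * R))).const_mul 2).congr_deriv ?_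
    field_simp
  refine (hchord.liminf_right_slope_le hr).mp ?_
  filter_upwards [Ioo_mem_nhdsGT ht.2] with z hz hslope
  refine lt_of_le_of_lt ?_ hslope
  rw [slope_def_field, slope_def_field]
  have hzt : 0 ≤ z - t := sub_nonneg.2 hz.1.le
  have htriangle := angle_le_angle_add_angle v (x t) (x z)
  have hangle := angle_le_two_mul_arcsin hR (hout t (Ico_subset_Icc_self ht))
    (hout z ⟨ht.1.trans hz.1.le, hz.2.le⟩)
  gcongr ?_ / _
  simp only [sub_self, norm_zero, zero_div, arcsin_zero, mul_zero, sub_zero]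
  linarith

theorem mul_angle_le_integral (hx : HasContinuousDerivOn x x' (Icc a b)) (hab : a ≤ b)
    (hR : 0 < R) (hout : ∀ t ∈ Icc a b, R ≤ ‖x t‖) :
    R * angle (x a) (x b) ≤ ∫ t in a..b, ‖x' t‖ := by
  have hne : ∀ t ∈ Icc a b, x t ≠ 0 := fun t ht => norm_pos_iff.1 (hR.trans_le (hout t ht))
  have hcont : ContinuousOn (fun t => angle (x a) (x t)) (Icc a b) := fun t ht =>
    (continuousAt_angle (x := (x a, x t)) (hne a (left_mem_Icc.2 hab)) (hne t ht))
      |>.comp_continuousWithinAt (f := fun t => (x a, x t))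
        (continuousWithinAt_const.prodMk (hx.continuousOn t ht))
  have hprim := continuousOn_integral_Icc hab hx.continuousOn_deriv.norm
  have hle := image_le_of_liminf_slope_right_le_deriv_boundary
    (f := fun t => angle (x a) (x t)) (B := fun t => (∫ s in a..t, ‖x' s‖) / R)
    (B' := fun t => ‖x' t‖ / R) hcont (by simp [angle_self (hne a (left_mem_Icc.2 hab))])
    (hprim.div_const R)
    (fun t ht => (hasDerivWithinAt_integral_Ici hx.continuousOn_deriv.norm ht).div_const R)
    (fun t ht r hr => hx.frequently_slope_angle_lt hR hout (x a) ht hr) (right_mem_Icc.2 hab)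
  exact (le_div_iff₀' hR).1 hle

theorem mul_angle_eq_integral (hx : HasContinuousDerivOn x x' (Icc a b)) (hR : 0 < R)
    (hout : ∀ t ∈ Icc a b, R ≤ ‖x t‖)
    (hlen : ∫ t in a..b, ‖x' t‖ ≤ R * angle (x a) (x b)) {s t : ℝ} (has : a ≤ s) (hst : s ≤ t)
    (htb : t ≤ b) : R * angle (x s) (x t) = ∫ u in s..t, ‖x' u‖ := by
  have hle : ∀ {c d}, a ≤ c → c ≤ d → d ≤ b → R * angle (x c) (x d) ≤ ∫ u in c..d, ‖x' u‖ :=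
    fun hac hcd hdb => (hx.mono (Icc_subset_Icc hac hdb)).mul_angle_le_integral hcd hR
      fun u hu => hout u (Icc_subset_Icc hac hdb hu)
  have htriangle : R * angle (x a) (x b) ≤
      R * angle (x a) (x s) + R * angle (x s) (x t) + R * angle (x t) (x b) := by
    rw [← mul_add, ← mul_add]
    gcongr
    linarith [angle_le_angle_add_angle (x a) (x s) (x b),
      angle_le_angle_add_angle (x s) (x t) (x b)]
  have hsplit := hx.integral_add_integral ⟨has, hst.trans htb⟩
  have hsplit' := (hx.mono (Icc_subset_Icc_left has)).integral_add_integral ⟨hst, htb⟩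
  linarith [hle le_rfl has (hst.trans htb), hle has hst htb, hle (has.trans hst) htb le_rfl]

theorem norm_eq_of_integral_le (hx : HasContinuousDerivOn x x' (Icc a b)) (hR : 0 < R)
    (hout : ∀ t ∈ Icc a b, R ≤ ‖x t‖) (ha : ‖x a‖ = R)
    (hlen : ∫ t in a..b, ‖x' t‖ ≤ R * angle (x a) (x b)) {t : ℝ} (ht : t ∈ Icc a b) :
    ‖x t‖ = R := by
  refine (hout t ht).antisymm' (le_of_not_gt fun hlt => ?_)
  -- A subpath outside a larger ball has length `R * angle`, yet at least the larger radius times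
  -- the angle: so the angle vanishes, the length with it, and the subpath is constant.
  obtain ⟨s, hs, hsR, hst⟩ := exists_eq_forall_Icc_le_of_continuousOn (y := (R + ‖x t‖) / 2) ht.1
    (hx.continuousOn.norm.mono (Icc_subset_Icc_right ht.2)) (by linarith) (by linarith)
  have hx' := hx.mono (Icc_subset_Icc hs.1 ht.2)
  have hlarge := hx'.mul_angle_le_integral hs.2 (by linarith) hst
  have heq := hx.mul_angle_eq_integral hR hout hlen hs.1 hs.2 ht.2
  have hchord := hx'.norm_sub_le_integral hs.2
  have hangle : angle (x s) (x t) = 0 := by nlinarith [angle_nonneg (x s) (x t)]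
  rw [← heq, hangle, mul_zero] at hchord
  have hts : x t = x s := sub_eq_zero.1 (norm_le_zero_iff.1 hchord)
  rw [hts] at hsR hlt
  linarith

theorem eq_slerp_of_integral_le (hx : HasContinuousDerivOn x x' (Icc a b)) (hR : 0 < R)
    (hout : ∀ t ∈ Icc a b, R ≤ ‖x t‖) (ha : ‖x a‖ = R)
    (hlen : ∫ t in a..b, ‖x' t‖ ≤ R * angle (x a) (x b)) (hsin : sin (angle (x a) (x b)) ≠ 0)
    {t : ℝ} (ht : t ∈ Icc a b) : x t = slerp (x a) (x b) ((∫ s in a..t, ‖x' s‖) / R) := by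
  have hnorm : ∀ s ∈ Icc a b, ‖x s‖ = R := fun s hs => hx.norm_eq_of_integral_le hR hout ha hlen hs
  have hab : a ≤ b := ht.1.trans ht.2
  have hat := hx.mul_angle_eq_integral hR hout hlen le_rfl ht.1 ht.2
  have htb := hx.mul_angle_eq_integral hR hout hlen ht.1 ht.2 le_rfl
  have hab' := hx.mul_angle_eq_integral hR hout hlen le_rfl hab le_rfl
  have hsplit := hx.integral_add_integral ht
  refine eq_slerp_of_angle_eq ha (hnorm b (right_mem_Icc.2 hab)) (hnorm t ht) hsin ?_ ?_
  · rw [← hat, mul_div_cancel_left₀ _ hR.ne']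
  · rw [← hat, mul_div_cancel_left₀ _ hR.ne']
    exact mul_left_cancel₀ hR.ne' (by linarith)

end HasContinuousDerivOn

end OutsideBall

section Reach

variable {D : ℕ} {M : Set (EuclideanSpace ℝ (Fin D))} {p q z : EuclideanSpace ℝ (Fin D)} {τ : ℝ}

theorem le_infDist_of_mem_medialAxis (hreach : ENNReal.ofReal τ ≤ reach M)
    (hz : z ∈ medialAxis M) : τ ≤ infDist z M := by
  have hne : M.Nonempty := let ⟨p, hp, _⟩ := hz; ⟨p, hp⟩
  exact (ENNReal.ofReal_le_iff_le_toReal (infEDist_ne_top hne)).1 (hreach.trans (iInf₂_le z hz))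

theorem hasUniqueNearestPoints_of_le_reach (hreach : ENNReal.ofReal τ ≤ reach M) :
    HasUniqueNearestPoints M τ := by
  intro x p q hx hp hq
  by_contra hpq
  exact hx.not_ge (le_infDist_of_mem_medialAxis hreach ⟨p, hp.mem, q, hq.mem, hpq,
    dist_comm p x ▸ hp.dist_eq, dist_comm q x ▸ hq.dist_eq⟩)

namespace IsReachAttainingPair

theorem symm (h : IsReachAttainingPair M p q z) : IsReachAttainingPair M q p z :=
  ⟨h.right_mem, h.left_mem, h.ne.symm, h.axis_mem, h.right_le, h.left_le⟩

theorem le_dist (h : IsReachAttainingPair M p q z) (hreach : ENNReal.ofReal τ ≤ reach M)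
    {x : EuclideanSpace ℝ (Fin D)} (hx : x ∈ M) : τ ≤ dist x z :=
  (le_infDist_of_mem_medialAxis hreach h.axis_mem).trans
    (dist_comm x z ▸ infDist_le_dist_of_mem hx)

theorem dist_left_eq (h : IsReachAttainingPair M p q z) (hτ : 0 ≤ τ)
    (hreach : reach M = ENNReal.ofReal τ) : dist p z = τ := by
  have hle := h.left_le
  rw [hreach, edist_dist, ENNReal.ofReal_le_ofReal_iff hτ] at hle
  exact hle.antisymm (h.le_dist hreach.ge h.left_mem)

theorem dist_right_eq (h : IsReachAttainingPair M p q z) (hτ : 0 ≤ τ)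
    (hreach : reach M = ENNReal.ofReal τ) : dist q z = τ :=
  h.symm.dist_left_eq hτ hreach

end IsReachAttainingPair

end Reach

section Paths

variable {D : ℕ} {M : Set (EuclideanSpace ℝ (Fin D))} {p q z : EuclideanSpace ℝ (Fin D)}
  {R a b : ℝ} {c : ℝ → EuclideanSpace ℝ (Fin D)}

theorem image_circularArc_Icc (hR : 0 < R) (hp : dist p z = R) (hq : dist q z = R)
    (h : sin (∠ p z q) ≠ 0) :
    circularArc z p q R '' Icc 0 (R * ∠ p z q) = shorterArc z p q := by
  have hscale : (fun t => t / R) '' Icc 0 (R * ∠ p z q) = Icc 0 (∠ p z q) := by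
    simp only [div_eq_mul_inv]
    rw [image_mul_right_Icc (mul_nonneg hR.le (EuclideanGeometry.angle_nonneg p z q))
      (inv_nonneg.2 hR.le), zero_mul, mul_comm R, mul_inv_cancel_right₀ hR.ne']
  have hp' : ‖p - z‖ = R := dist_eq_norm p z ▸ hp
  have hq' : ‖q - z‖ = R := dist_eq_norm q z ▸ hq
  calc circularArc z p q R '' Icc 0 (R * ∠ p z q)
      = (z + ·) '' (slerp (p - z) (q - z) '' Icc 0 (∠ p z q)) := by
        rw [← hscale, image_image, image_image]
        rfl
    _ = (z + ·) '' {u | ‖u‖ = R ∧ ∃ a b : ℝ, 0 ≤ a ∧ 0 ≤ b ∧ u = a • (p - z) + b • (q - z)} :=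
        congrArg _ (image_slerp_Icc hR hp' hq' h)
    _ = shorterArc z p q := by
        rw [image_add_left]
        ext x
        simp only [shorterArc, mem_preimage, mem_ofPred_eq, neg_add_eq_sub, dist_eq_norm, hp']

theorem pathLength_eq_sub_of_norm_derivWithin_eq_one (hab : a ≤ b)
    (hunit : ∀ t ∈ Icc a b, ‖derivWithin c (Icc a b) t‖ = 1) : pathLength a b c = b - a := by
  rw [pathLength, intervalIntegral.integral_congr (g := fun _ => (1 : ℝ))
    (fun t ht => hunit t (uIcc_of_le hab ▸ ht)), integral_one]

theorem pathLength_circularArc (hR : 0 < R) (hp : dist p z = R) (hq : dist q z = R)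
    (h : sin (∠ p z q) ≠ 0) :
    pathLength 0 (R * ∠ p z q) (circularArc z p q R) = R * ∠ p z q := by
  have hpos : 0 < R * ∠ p z q := mul_pos hR (angle_pos_of_sin_angle_ne_zero h)
  rw [pathLength_eq_sub_of_norm_derivWithin_eq_one hpos.le, sub_zero]
  intro t ht
  rw [((contDiff_circularArc z p q R).differentiable (by simp) t).derivWithin
    (uniqueDiffOn_Icc hpos t ht), norm_deriv_circularArc hR hp hq h]

namespace IsPathIn

theorem lt (hc : IsPathIn M p q a b c) (hpq : p ≠ q) : a < b :=
  hc.le.lt_of_ne fun hab => hpq (by rw [← hc.source, ← hc.target, hab])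

theorem hasContinuousDerivOn (hc : IsPathIn M p q a b c) (hpq : p ≠ q)
    (z : EuclideanSpace ℝ (Fin D)) :
    HasContinuousDerivOn (fun t => c t - z) (derivWithin c (Icc a b)) (Icc a b) where
  hasDerivWithinAt t ht :=
    (hc.contDiffOn.differentiableOn one_ne_zero t ht).hasDerivWithinAt.sub_const z
  continuousOn_deriv :=
    hc.contDiffOn.continuousOn_derivWithin (uniqueDiffOn_Icc (hc.lt hpq)) le_rfl

theorem le_norm_sub (hc : IsPathIn M p q a b c) (hz : ∀ x ∈ M, R ≤ dist x z) {t : ℝ}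
    (ht : t ∈ Icc a b) : R ≤ ‖c t - z‖ :=
  dist_eq_norm (c t) z ▸ hz _ (hc.mapsTo ht)

theorem mul_angle_le_pathLength (hc : IsPathIn M p q a b c) (hpq : p ≠ q) (hR : 0 < R)
    (hz : ∀ x ∈ M, R ≤ dist x z) : R * ∠ p z q ≤ pathLength a b c := by
  have := (hc.hasContinuousDerivOn hpq z).mul_angle_le_integral hc.le hR
    fun t ht => hc.le_norm_sub hz ht
  rwa [hc.source, hc.target] at this

theorem eq_circularArc_of_pathLength_le (hc : IsPathIn M p q a b c) (hpq : p ≠ q) (hR : 0 < R)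
    (hz : ∀ x ∈ M, R ≤ dist x z) (hp : dist p z = R) (h : sin (∠ p z q) ≠ 0)
    (hlen : pathLength a b c ≤ R * ∠ p z q) {t : ℝ} (ht : t ∈ Icc a b) :
    c t = circularArc z p q R (∫ s in a..t, ‖derivWithin c (Icc a b) s‖) := by
  have hslerp := (hc.hasContinuousDerivOn hpq z).eq_slerp_of_integral_le hR
    (fun t ht => hc.le_norm_sub hz ht) (hc.source ▸ dist_eq_norm p z ▸ hp)
    (by rwa [hc.source, hc.target]) (by rwa [hc.source, hc.target]) ht
  rw [hc.source, hc.target] at hslerp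
  rw [circularArc, ← hslerp, add_sub_cancel]

theorem image_eq_shorterArc_of_pathLength_le (hc : IsPathIn M p q a b c) (hpq : p ≠ q)
    (hR : 0 < R) (hz : ∀ x ∈ M, R ≤ dist x z) (hp : dist p z = R) (hq : dist q z = R)
    (h : sin (∠ p z q) ≠ 0) (hlen : pathLength a b c ≤ R * ∠ p z q) :
    c '' Icc a b = shorterArc z p q := by
  have heq : R * ∠ p z q = ∫ t in a..b, ‖derivWithin c (Icc a b) t‖ :=
    (hc.mul_angle_le_pathLength hpq hR hz).antisymm hlen
  rw [← image_circularArc_Icc hR hp hq h, heq, ← image_integral_Icc hc.le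
    (hc.hasContinuousDerivOn hpq z).continuousOn_deriv.norm fun _ => norm_nonneg _, image_image]
  exact image_congr fun t ht => hc.eq_circularArc_of_pathLength_le hpq hR hz hp h hlen ht

theorem eq_mul_angle_of_norm_derivWithin_eq_one {ℓ : ℝ} (hc : IsPathIn M p q 0 ℓ c) (hpq : p ≠ q)
    (hR : 0 < R) (hz : ∀ x ∈ M, R ≤ dist x z) (hlen : pathLength 0 ℓ c ≤ R * ∠ p z q)
    (hunit : ∀ t ∈ Icc 0 ℓ, ‖derivWithin c (Icc 0 ℓ) t‖ = 1) : ℓ = R * ∠ p z q := by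
  rw [← sub_zero ℓ, ← pathLength_eq_sub_of_norm_derivWithin_eq_one hc.le hunit]
  exact hlen.antisymm (hc.mul_angle_le_pathLength hpq hR hz)

theorem eqOn_circularArc_of_norm_derivWithin_eq_one {ℓ : ℝ} (hc : IsPathIn M p q 0 ℓ c)
    (hpq : p ≠ q) (hR : 0 < R) (hz : ∀ x ∈ M, R ≤ dist x z) (hp : dist p z = R)
    (h : sin (∠ p z q) ≠ 0) (hlen : pathLength 0 ℓ c ≤ R * ∠ p z q)
    (hunit : ∀ t ∈ Icc 0 ℓ, ‖derivWithin c (Icc 0 ℓ) t‖ = 1) :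
    EqOn c (circularArc z p q R) (Icc 0 ℓ) := by
  intro t ht
  rw [hc.eq_circularArc_of_pathLength_le hpq hR hz hp h hlen ht,
    intervalIntegral.integral_congr (g := fun _ => (1 : ℝ)) fun s hs => hunit s ?_,
    integral_one, sub_zero]
  rw [uIcc_of_le ht.1] at hs
  exact Icc_subset_Icc_right ht.2 hs

end IsPathIn

theorem isGeodesic_circularArc (hR : 0 < R) (hz : ∀ x ∈ M, R ≤ dist x z) (hp : dist p z = R)
    (hq : dist q z = R) (hpq : p ≠ q) (h : sin (∠ p z q) ≠ 0)
    (hmem : MapsTo (circularArc z p q R) (Icc 0 (R * ∠ p z q)) M) :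
    IsGeodesic M p q 0 (R * ∠ p z q) (circularArc z p q R) where
  left :=
    { le := mul_nonneg hR.le (EuclideanGeometry.angle_nonneg p z q)
      contDiffOn := ((contDiff_circularArc z p q R).of_le (mod_cast le_top)).contDiffOn
      mapsTo := hmem
      source := circularArc_zero h
      target := circularArc_mul_angle hR.ne' h }
  right _ _ _ hc :=
    (pathLength_circularArc hR hp hq h).trans_le (hc.mul_angle_le_pathLength hpq hR hz)

end Paths

theorem mainTheorem2_general {D : ℕ} (M : Set (EuclideanSpace ℝ (Fin D))) (hclosed : IsClosed M)
    (τ : ℝ) (hreach : reach M = ENNReal.ofReal τ)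
    (q₁ q₂ z₀ : EuclideanSpace ℝ (Fin D)) (hpair : IsReachAttainingPair M q₁ q₂ z₀)
    (hsize : ‖q₁ - q₂‖ < 2 * τ) :
    (dist q₁ z₀ = τ ∧ dist q₂ z₀ = τ) ∧
    shorterArc z₀ q₁ q₂ ⊆ M ∧
    ∃ (ℓ : ℝ) (γ : ℝ → EuclideanSpace ℝ (Fin D)),
      ℓ = τ * EuclideanGeometry.angle q₁ z₀ q₂ ∧
      γ '' Set.Icc 0 ℓ = shorterArc z₀ q₁ q₂ ∧
      ContDiff ℝ ∞ γ ∧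
      (∀ t ∈ Set.Icc 0 ℓ, ‖deriv γ t‖ = 1) ∧
      (∀ t ∈ Set.Icc 0 ℓ, ‖deriv (deriv γ) t‖ = 1 / τ) ∧
      IsGeodesic M q₁ q₂ 0 ℓ γ ∧
      (∀ (ℓ' : ℝ) (c : ℝ → EuclideanSpace ℝ (Fin D)), IsGeodesic M q₁ q₂ 0 ℓ' c →
        (∀ t ∈ Set.Icc 0 ℓ', ‖derivWithin c (Set.Icc 0 ℓ') t‖ = 1) →
          ℓ' = ℓ ∧ Set.EqOn c γ (Set.Icc 0 ℓ)) ∧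
      (∀ (a b : ℝ) (c : ℝ → EuclideanSpace ℝ (Fin D)), IsGeodesic M q₁ q₂ a b c →
        c '' Set.Icc a b = shorterArc z₀ q₁ q₂) := by
  have hτ : 0 < τ := by linarith [norm_nonneg (q₁ - q₂)]
  have h₁ : dist q₁ z₀ = τ := hpair.dist_left_eq hτ.le hreach
  have h₂ : dist q₂ z₀ = τ := hpair.dist_right_eq hτ.le hreach
  have hout : ∀ x ∈ M, τ ≤ dist x z₀ := fun x hx => hpair.le_dist hreach.ge hx
  have hsin := sin_angle_ne_zero_of_dist_lt h₁ h₂ hpair.ne (dist_eq_norm q₁ q₂ ▸ hsize)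
  have himage := image_circularArc_Icc hτ h₁ h₂ hsin
  have hmem : MapsTo (circularArc z₀ q₁ q₂ τ) (Icc 0 (τ * ∠ q₁ z₀ q₂)) M := fun t ht =>
    (hasUniqueNearestPoints_of_le_reach hreach.ge).circularArc_mem hclosed hout hτ h₁ h₂ hsin
      hpair.left_mem hpair.right_mem ht
  have hgeodesic := isGeodesic_circularArc hτ hout h₁ h₂ hpair.ne hsin hmem
  have hlen : ∀ {a b c}, IsGeodesic M q₁ q₂ a b c → pathLength a b c ≤ τ * ∠ q₁ z₀ q₂ :=
    fun hc => (hc.2 _ _ _ hgeodesic.1).trans_eq (pathLength_circularArc hτ h₁ h₂ hsin)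
  refine ⟨⟨h₁, h₂⟩, himage ▸ hmem.image_subset, τ * ∠ q₁ z₀ q₂, circularArc z₀ q₁ q₂ τ, rfl, himage,
    contDiff_circularArc z₀ q₁ q₂ τ, fun t _ => norm_deriv_circularArc hτ h₁ h₂ hsin t,
    fun t _ => norm_deriv_deriv_circularArc hτ h₁ h₂ hsin t, hgeodesic, fun ℓ' c hc hunit => ?_,
    fun _ _ _ hc =>
      hc.1.image_eq_shorterArc_of_pathLength_le hpair.ne hτ hout h₁ h₂ hsin (hlen hc)⟩
  have hℓ' := hc.1.eq_mul_angle_of_norm_derivWithin_eq_one hpair.ne hτ hout (hlen hc) hunit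
  exact ⟨hℓ', hℓ' ▸ hc.1.eqOn_circularArc_of_norm_derivWithin_eq_one hpair.ne hτ hout h₁ hsin
    (hlen hc) hunit⟩

theorem mainTheorem2 {D d : ℕ} (M : Set (EuclideanSpace ℝ (Fin D)))
    (hcompact : IsCompact M) (hM : IsSubmanifold 1 d M)
    (τ : ℝ) (hτ : 0 < τ) (hreach : reach M = ENNReal.ofReal τ)
    (q₁ q₂ z₀ : EuclideanSpace ℝ (Fin D)) (hpair : IsReachAttainingPair M q₁ q₂ z₀)
    (hsize : ‖q₁ - q₂‖ < 2 * τ) :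
    (dist q₁ z₀ = τ ∧ dist q₂ z₀ = τ) ∧
    shorterArc z₀ q₁ q₂ ⊆ M ∧
    ∃ (ℓ : ℝ) (γ : ℝ → EuclideanSpace ℝ (Fin D)),
      -- `γ : [0, ℓ] → M` is an arc-length parametrization of the arc, of curvature `1 / τ`
      ℓ = τ * EuclideanGeometry.angle q₁ z₀ q₂ ∧
      γ '' Set.Icc 0 ℓ = shorterArc z₀ q₁ q₂ ∧
      ContDiff ℝ ∞ γ ∧
      (∀ t ∈ Set.Icc 0 ℓ, ‖deriv γ t‖ = 1) ∧
      (∀ t ∈ Set.Icc 0 ℓ, ‖deriv (deriv γ) t‖ = 1 / τ) ∧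
      -- it is a geodesic of `M` from `q₁` to `q₂`
      IsGeodesic M q₁ q₂ 0 ℓ γ ∧
      -- and it is the only one, up to the choice of the parametrization
      (∀ (ℓ' : ℝ) (c : ℝ → EuclideanSpace ℝ (Fin D)), IsGeodesic M q₁ q₂ 0 ℓ' c →
        (∀ t ∈ Set.Icc 0 ℓ', ‖derivWithin c (Set.Icc 0 ℓ') t‖ = 1) →
          ℓ' = ℓ ∧ Set.EqOn c γ (Set.Icc 0 ℓ)) ∧
      (∀ (a b : ℝ) (c : ℝ → EuclideanSpace ℝ (Fin D)), IsGeodesic M q₁ q₂ a b c →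
        c '' Set.Icc a b = shorterArc z₀ q₁ q₂) :=
  mainTheorem2_general M hcompact.isClosed τ hreach q₁ q₂ z₀ hpair hsize
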